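/- A packing $k$-coloring of a graph $G$ is a map $\pi:V(G)\to\{1,\dots,k\}$ such that any two distinct vertices $u,v$ with $\pi(u)=\pi(v)=i$ are at distance $d_G(u,v)>i$; the packing chromatic number $\chi_\rho(G)$ is the smallest $k$ for which $G$ has a packing $k$-coloring. For $n\ge 3$ let $C_n$ be the cycle on $n$ vertices, and let $C_n\odot 3K_1$ be the graph obtained from $C_n$ by adding three new degree-one neighbors to every vertex of $C_n$. **Theorem.** For every integer $n\ge 3$, $$\chi_\rho(C_n\odot 3K_1)=\begin{cases}4 & \text{if } n=3,\\ 5 & \text{if } n=4,\\ 7 & \text{if } n\in E,\\ 6 & \text{otherwise,}\end{cases}$$ where $$E=\{7,\dots,13\}\cup\{15,\dots,22\}\cup\{24,\dots,27\}\cup\{30,\dots,36\}\cup\{39,40,41\}\cup\{45\}\cup\{47,\dots,50\}\cup\{53,54,55,59,62,63,64,68,77,78,91\}.$$ -/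

import Mathlib

/-- `c` is a packing `k`-coloring of `G`: all colors lie in `{1, …, k}`, and two distinct vertices
of the same color `i` are at distance greater than `i` (vertices in different components are at
distance `⊤`). -/
def SimpleGraph.IsPackingColoring {V : Type*} (G : SimpleGraph V) (k : ℕ) (c : V → ℕ) : Prop :=
  (∀ v, 1 ≤ c v ∧ c v ≤ k) ∧
    ∀ u v, u ≠ v → c u = c v → (c u : ℕ∞) < G.edist u v

/-- The graph `G` admits a packing `k`-coloring. -/
def SimpleGraph.PackingColorable {V : Type*} (G : SimpleGraph V) (k : ℕ) : Prop :=
  ∃ c : V → ℕ, G.IsPackingColoring k c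

/-- The packing chromatic number of `G`: the smallest `k` such that `G` admits a packing
`k`-coloring (and `⊤` if there is no such `k`). -/
noncomputable def SimpleGraph.packingChromaticNumber {V : Type*} (G : SimpleGraph V) : ℕ∞ :=
  ⨅ k ∈ {k : ℕ | G.PackingColorable k}, (k : ℕ∞)

/-- The generalized corona `G ⊙ pK₁`: to every vertex `v` of `G` (now `Sum.inl v`) we add `p`
new neighbors `Sum.inr (v, i)`, `i : Fin p`, each of degree one. -/
def SimpleGraph.generalizedCorona {V : Type*} (G : SimpleGraph V) (p : ℕ) :
    SimpleGraph (V ⊕ V × Fin p) where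
  Adj
    | Sum.inl u, Sum.inl v => G.Adj u v
    | Sum.inl u, Sum.inr w => u = w.1
    | Sum.inr w, Sum.inl u => u = w.1
    | Sum.inr _, Sum.inr _ => False
  symm := ⟨by
    rintro (u | u) (v | v) h
    · exact SimpleGraph.Adj.symm h
    · exact h
    · exact h
    · exact h⟩
  loopless := ⟨by
    rintro (u | u) h
    · exact G.loopless.irrefl u h
    · exact h⟩

/-! Distinct vertices of the corona are as far apart as their base vertices on the cycle, plus one
for each of the two that is a leaf. If a cycle vertex does not have color 1, all its leaves may be
recolored 1; if it has color 1, its leaves carry three different colors, all at least 2. So a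
packing `k`-coloring amounts to a cyclic word over a finite alphabet of letters, with constraints
only between letters at distance at most `k`.

Recording for each color how long it stays blocked turns admissible words into runs of a finite
automaton. A closed run of length `n ≥ 3` gives a coloring for `C_n` (`packingColorable_of_run`),
and for `n > k` a coloring gives an `n`-periodic run (`exists_periodic_word`).

With five colors the reachable part of the automaton is acyclic, so there is no infinite run. With
six colors every infinite run meets one of two hub states, those right after the letters 5, (1, [2,
3, 4]), 6 and after 6, (1, [2, 3, 4]), 5. Hence `n` is a sum of first-return lengths along a closed
path between hubs, and no exceptional length is such a sum (`mem_loopLengths`). For every other `n ≥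
7`, loops of lengths 14, 23, 29, 38 and 44 at the first hub combine to length `n` (`hasLoop_six`).
Seven colors allow loops of every length from 7 on (`hasLoop_seven`). Cycles with `n ≤ 6` are
colored explicitly, and finite checks give the lower bounds where `k = n`. -/

/-! ### Distances in the corona of a cycle -/

/-- Distance between positions `i` and `j` on a cycle of length `n`. -/
def cycDist (n i j : ℕ) : ℕ := min (i - j + (j - i)) (n - (i - j + (j - i)))

theorem cycDist_triangle {n i j k : ℕ} (hi : i < n) (hj : j < n) (hk : k < n) :
    cycDist n i k ≤ cycDist n i j + cycDist n j k := by
  unfold cycDist; omega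

theorem cycDist_comm (n i j : ℕ) : cycDist n i j = cycDist n j i := by
  unfold cycDist; omega

theorem cycDist_eq_zero {n i j : ℕ} (hi : i < n) (hj : j < n) : cycDist n i j = 0 ↔ i = j := by
  unfold cycDist; omega

theorem cycDist_of_lt {n i j : ℕ} (h : i < j) : cycDist n i j = min (j - i) (n - (j - i)) := by
  unfold cycDist; omega

theorem cycleGraph_adj_iff_cycDist {n : ℕ} (hn : 3 ≤ n) (u v : Fin n) :
    (SimpleGraph.cycleGraph n).Adj u v ↔ cycDist n u v = 1 := by
  have key : ∀ a b : Fin n, ((a - b).val = a - b ∧ b.val ≤ a) ∨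
      ((a - b).val = n + a - b ∧ a.val < b) := by
    intro a b
    rcases le_or_gt b.val a.val with h | h
    · left; exact ⟨Fin.sub_val_of_le h, h⟩
    · right
      refine ⟨?_, h⟩
      rw [Fin.sub_def]
      have := b.isLt
      simp only
      rw [Nat.mod_eq_of_lt (by omega)]
      omega
  rw [SimpleGraph.cycleGraph_adj']
  have h1 := key u v
  have h2 := key v u
  have := u.isLt
  have := v.isLt
  unfold cycDist
  omega

theorem exists_cycDist_step {n u v d : ℕ} (hn : 3 ≤ n) (hu : u < n) (hv : v < n)
    (h : cycDist n u v = d + 1) : ∃ k < n, cycDist n u k = 1 ∧ cycDist n k v = d := by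
  unfold cycDist at *
  rcases lt_or_ge u v with huv | huv
  · by_cases hd : v - u ≤ n - (v - u)
    · exact ⟨u + 1, by omega, by omega, by omega⟩
    · by_cases h0 : u = 0
      · exact ⟨n - 1, by omega, by omega, by omega⟩
      · exact ⟨u - 1, by omega, by omega, by omega⟩
  · by_cases hd : u - v ≤ n - (u - v)
    · exact ⟨u - 1, by omega, by omega, by omega⟩
    · by_cases h0 : u = n - 1
      · exact ⟨0, by omega, by omega, by omega⟩
      · exact ⟨u + 1, by omega, by omega, by omega⟩

namespace SimpleGraph.CycleCorona

variable {n p : ℕ}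

/-- The cycle vertex that a vertex of the corona is attached to. -/
def base : Fin n ⊕ Fin n × Fin p → Fin n
  | Sum.inl u => u
  | Sum.inr w => w.1

/-- The distance from a vertex of the corona to the cycle. -/
def height : Fin n ⊕ Fin n × Fin p → ℕ
  | Sum.inl _ => 0
  | Sum.inr _ => 1

theorem edist_inl_le (hn : 3 ≤ n) : ∀ (d : ℕ) (u v : Fin n), cycDist n u v = d →
    ((cycleGraph n).generalizedCorona p).edist (Sum.inl u) (Sum.inl v) ≤ d := by
  intro d
  induction d with
  | zero =>
    intro u v h
    rw [cycDist_eq_zero u.isLt v.isLt, ← Fin.ext_iff] at h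
    simp [h]
  | succ d ih =>
    intro u v h
    obtain ⟨k, hk, h1, h2⟩ := exists_cycDist_step hn u.isLt v.isLt h
    have hadj : ((cycleGraph n).generalizedCorona p).Adj (Sum.inl u) (Sum.inl ⟨k, hk⟩) :=
      (cycleGraph_adj_iff_cycDist hn u ⟨k, hk⟩).2 h1
    calc _ ≤ _ := SimpleGraph.edist_triangle (v := Sum.inl ⟨k, hk⟩)
      _ ≤ 1 + (d : ℕ∞) := add_le_add (edist_eq_one_iff_adj.2 hadj).le (ih ⟨k, hk⟩ v h2)
      _ = _ := by push_cast; ring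

theorem edist_base_le (a : Fin n ⊕ Fin n × Fin p) :
    ((cycleGraph n).generalizedCorona p).edist a (Sum.inl (base a)) ≤ height a := by
  rcases a with u | w
  · simp [base]
  · have hadj : ((cycleGraph n).generalizedCorona p).Adj (Sum.inr w) (Sum.inl w.1) := rfl
    simpa [height, base] using (edist_eq_one_iff_adj.2 hadj).le

theorem edist_le (hn : 3 ≤ n) (a b : Fin n ⊕ Fin n × Fin p) :
    ((cycleGraph n).generalizedCorona p).edist a b ≤
      (height a + cycDist n (base a) (base b) + height b : ℕ) := by
  have h1 := edist_base_le a
  have h2 := edist_base_le b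
  rw [edist_comm] at h2
  have h3 := edist_inl_le (p := p) hn _ (base a) (base b) rfl
  calc _ ≤ _ := SimpleGraph.edist_triangle (v := Sum.inl (base b))
    _ ≤ _ := add_le_add (SimpleGraph.edist_triangle (v := Sum.inl (base a))) le_rfl
    _ ≤ _ := add_le_add (add_le_add h1 h3) h2
    _ = _ := by push_cast; ring

/-- The claimed distance from `a` is a potential that changes by at most one along an edge, so no
walk can be shorter than it. Its value at `a` itself must be set to 0 separately, because the
formula gives 2 when `a` is a leaf. -/
theorem potential_le_of_adj (hn : 3 ≤ n) (a : Fin n ⊕ Fin n × Fin p)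
    {b c : Fin n ⊕ Fin n × Fin p}
    (h : ((cycleGraph n).generalizedCorona p).Adj b c) :
    (if a = b then 0 else height a + cycDist n (base a) (base b) + height b) ≤
      (if a = c then 0 else height a + cycDist n (base a) (base c) + height c) + 1 := by
  have hbc : cycDist n (base c) (base b) + height b ≤ height c + 1 ∧
      height b ≤ cycDist n (base c) (base b) + height c + 1 ∧
      cycDist n (base c) (base b) + height b + height c = 1 := by
    rcases b with u | w <;> rcases c with u' | w'
    · have : cycDist n u u' = 1 := (cycleGraph_adj_iff_cycDist hn u u').1 h
      rw [cycDist_comm] at this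
      simp [base, height, this]
    · have : u = w'.1 := h
      simp [base, height, this, cycDist]
    · have : u' = w.1 := h
      simp [base, height, this, cycDist]
    · exact h.elim
  have htri := cycDist_triangle (base a).isLt (base c).isLt (base b).isLt
  split_ifs with h1 h2 h2
  · omega
  · omega
  · subst h2; omega
  · omega

theorem le_edist (hn : 3 ≤ n) {a b : Fin n ⊕ Fin n × Fin p} (hab : a ≠ b) :
    ((height a + cycDist n (base a) (base b) + height b : ℕ) : ℕ∞) ≤
      ((cycleGraph n).generalizedCorona p).edist a b := by
  have key : ∀ {b c : Fin n ⊕ Fin n × Fin p}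
      (w : ((cycleGraph n).generalizedCorona p).Walk b c),
      (if a = b then 0 else height a + cycDist n (base a) (base b) + height b) ≤
      (if a = c then 0 else height a + cycDist n (base a) (base c) + height c) + w.length := by
    intro b c w
    induction w with
    | nil => simp
    | cons h w ih =>
      have := potential_le_of_adj hn a h
      rw [Walk.length_cons]
      omega
  rw [edist_comm]
  refine le_iInf fun w => ?_
  have := key w
  rw [if_neg hab, if_pos rfl, zero_add] at this
  exact_mod_cast this

theorem lt_edist_iff (hn : 3 ≤ n) {a b : Fin n ⊕ Fin n × Fin p} (hab : a ≠ b) (m : ℕ) :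
    (m : ℕ∞) < ((cycleGraph n).generalizedCorona p).edist a b ↔
      m < height a + cycDist n (base a) (base b) + height b := by
  rw [le_antisymm (edist_le hn a b) (le_edist hn hab)]
  exact_mod_cast Iff.rfl

end SimpleGraph.CycleCorona

/-! ### Packing colorings as cyclic words -/

/-- The colors that a packing coloring of the corona uses at one cycle vertex and its leaves:
the color of the cycle vertex, and the colors different from `1` that must occur on its leaves. -/
abbrev PackingLetter := ℕ × List ℕ

namespace PackingLetter

/-- The letters `(j, [])` with `2 ≤ j ≤ k`, and `(1, [a, b, c])` with `2 ≤ a < b < c ≤ k`. -/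
def letters (k : ℕ) : List PackingLetter :=
  let l := List.range' 2 (k - 1)
  l.map (fun j => (j, [])) ++ l.flatMap fun a => l.flatMap fun b => l.flatMap fun c =>
    bif Nat.blt a b && Nat.blt b c then [(1, [a, b, c])] else []

theorem mem_letters {k : ℕ} {x : PackingLetter} : x ∈ letters k ↔
    (∃ j, 2 ≤ j ∧ j ≤ k ∧ x = (j, [])) ∨
      ∃ a b c, 2 ≤ a ∧ a < b ∧ b < c ∧ c ≤ k ∧ x = (1, [a, b, c]) := by
  have hr : ∀ j, j ∈ List.range' 2 (k - 1) ↔ 2 ≤ j ∧ j ≤ k := by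
    intro j; rw [List.mem_range'_1]; omega
  have hif : ∀ a b c : ℕ, (x ∈ bif Nat.blt a b && Nat.blt b c then [((1, [a, b, c]) : PackingLetter)]
      else []) ↔ a < b ∧ b < c ∧ x = (1, [a, b, c]) := by
    intro a b c
    cases h : (Nat.blt a b && Nat.blt b c)
    · simp only [cond_false, List.not_mem_nil, false_iff]
      rintro ⟨h1, h2, -⟩
      have h3 : Nat.blt a b = true := Nat.ble_eq_true_of_le h1
      have h4 : Nat.blt b c = true := Nat.ble_eq_true_of_le h2
      simp [h3, h4] at h
    · rw [Bool.and_eq_true] at h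
      simp only [cond_true, List.mem_singleton]
      have h3 : a < b := Nat.le_of_ble_eq_true h.1
      have h4 : b < c := Nat.le_of_ble_eq_true h.2
      simp [h3, h4]
  simp only [letters, List.mem_append, List.mem_map, List.mem_flatMap, hr, hif]
  constructor
  · rintro (⟨j, ⟨h1, h2⟩, rfl⟩ | ⟨a, ha, b, hb, c, hc, h1, h2, rfl⟩)
    · exact Or.inl ⟨j, h1, h2, rfl⟩
    · exact Or.inr ⟨a, b, c, ha.1, h1, h2, hc.2, rfl⟩
  · rintro (⟨j, h1, h2, rfl⟩ | ⟨a, b, c, h1, h2, h3, h4, rfl⟩)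
    · exact Or.inl ⟨j, ⟨h1, h2⟩, rfl⟩
    · exact Or.inr ⟨a, ⟨h1, by omega⟩, b, ⟨by omega, by omega⟩, c, ⟨by omega, h4⟩, h2, h3, rfl⟩

/-- Two letters may stand at cycle distance `d` of each other. -/
def Compat (d : ℕ) (x y : PackingLetter) : Prop :=
  (x.1 = y.1 → x.1 < d) ∧ (∀ j ∈ y.2, x.1 = j → j < d + 1) ∧ (∀ j ∈ x.2, y.1 = j → j < d + 1) ∧
    ∀ i ∈ x.2, ∀ j ∈ y.2, i = j → j < d + 2

instance (d : ℕ) (x y : PackingLetter) : Decidable (Compat d x y) := by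
  unfold Compat; infer_instance

theorem Compat.symm {d : ℕ} {x y : PackingLetter} (h : Compat d x y) : Compat d y x :=
  ⟨fun e => e ▸ h.1 e.symm, h.2.2.1, h.2.1, fun i hi j hj e => e ▸ h.2.2.2 j hj i hi e.symm⟩

theorem Compat.mono {d e : ℕ} {x y : PackingLetter} (h : Compat d x y) (hde : d ≤ e) :
    Compat e x y :=
  ⟨fun h1 => (h.1 h1).trans_le hde, fun j hj h1 => (h.2.1 j hj h1).trans_le (by omega),
    fun j hj h1 => (h.2.2.1 j hj h1).trans_le (by omega),
    fun i hi j hj h1 => (h.2.2.2 i hi j hj h1).trans_le (by omega)⟩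

theorem compat_of_lt {k d : ℕ} {x y : PackingLetter} (hy : y ∈ letters k) (hx : x ∈ letters k)
    (h : k < d) : Compat d x y := by
  have key : ∀ z ∈ letters k, z.1 ≤ k ∧ ∀ j ∈ z.2, j ≤ k := by
    intro z hz
    rcases mem_letters.1 hz with ⟨j, h1, h2, rfl⟩ | ⟨a, b, c, h1, h2, h3, h4, rfl⟩
    · simpa using h2
    · simp; omega
  refine ⟨fun _ => (key x hx).1.trans_lt h, fun j hj _ => ?_, fun j hj _ => ?_,
    fun i hi j hj _ => ?_⟩
  · have := (key y hy).2 j hj; omega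
  · have := (key x hx).2 j hj; omega
  · have := (key y hy).2 j hj; omega

end PackingLetter

open PackingLetter SimpleGraph.CycleCorona in
-- A leaf of color 1 conflicts only with its own base vertex, since every other vertex is at
-- distance at least 2. Letters therefore need not record it.
theorem packingColorable_of_word {n k : ℕ} (hn : 3 ≤ n) (hk : 1 ≤ k) (x : ℕ → PackingLetter)
    (hx : ∀ i < n, x i ∈ letters k)
    (hc : ∀ i j, i < j → j < n → Compat (cycDist n i j) (x i) (x j)) :
    ((SimpleGraph.cycleGraph n).generalizedCorona 3).PackingColorable k := by
  have hc' : ∀ i j : Fin n, i ≠ j → Compat (cycDist n i j) (x i) (x j) := by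
    intro i j hij
    rcases lt_or_gt_of_ne (fun h => hij (Fin.ext h) : i.val ≠ j.val) with h | h
    · exact hc i j h j.isLt
    · rw [cycDist_comm]; exact (hc j i h i.isLt).symm
  have hleaf : ∀ (u : Fin n) (a : Fin 3), (x u).2.getD a 1 ∈ (x u).2 ∨
      ((x u).2.getD a 1 = 1 ∧ (x u).1 ≠ 1) := by
    intro u a
    rcases mem_letters.1 (hx u u.isLt) with ⟨j, h1, h2, h⟩ | ⟨a', b, c, h1, h2, h3, h4, h⟩
    · right; rw [h]; simp; omega
    · left; rw [h]; fin_cases a <;> simp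
  have htwo : ∀ (u : Fin n), ∀ j ∈ (x u).2, 2 ≤ j ∧ j ≤ k ∧ (x u).1 = 1 := by
    intro u
    rcases mem_letters.1 (hx u u.isLt) with ⟨j, h1, h2, h⟩ | ⟨a', b, c, h1, h2, h3, h4, h⟩
    · rw [h]; simp
    · rw [h]; simp; omega
  have hinj : ∀ (u : Fin n) (a b : Fin 3), a ≠ b → (x u).2.getD a 1 = (x u).2.getD b 1 →
      (x u).2.getD a 1 = 1 := by
    intro u a b hab
    rcases mem_letters.1 (hx u u.isLt) with ⟨j, h1, h2, h⟩ | ⟨a', b', c, h1, h2, h3, h4, h⟩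
    · rw [h]; simp
    · rw [h]
      intro e
      exfalso
      fin_cases a <;> fin_cases b <;> simp at e hab <;> omega
  have hvert : ∀ (u : Fin n), 1 ≤ (x u).1 ∧ (x u).1 ≤ k := by
    intro u
    rcases mem_letters.1 (hx u u.isLt) with ⟨j, h1, h2, h⟩ | ⟨a', b', c, h1, h2, h3, h4, h⟩
    · rw [h]; simp; omega
    · rw [h]; simp; omega
  -- The default `1` of `getD` colors all leaves of a letter `(j, [])` with 1.
  refine ⟨fun v => match v with
    | Sum.inl u => (x u).1
    | Sum.inr w => (x w.1).2.getD w.2 1, ?_, ?_⟩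
  · rintro (u | w)
    · exact hvert u
    · rcases hleaf w.1 w.2 with h | h
      · have := htwo _ _ h
        simp only; omega
      · simp only [h.1]; omega
  · intro a b hab he
    rw [lt_edist_iff hn hab]
    rcases a with u | ⟨u, a⟩ <;> rcases b with v | ⟨v, b⟩ <;> simp only at he <;>
      simp only [height, base]
    · have := (hc' u v (by rintro rfl; exact hab rfl)).1 he
      omega
    · rcases hleaf v b with h | h
      · by_cases huv : u = v
        · subst huv
          have := htwo u _ h
          omega
        · have := (hc' u v huv).2.1 _ h he
          omega
      · by_cases huv : u = v
        · subst huv; omega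
        · have := mt (cycDist_eq_zero u.isLt v.isLt).1 (fun h => huv (Fin.ext h))
          omega
    · rcases hleaf u a with h | h
      · by_cases huv : u = v
        · subst huv
          have := htwo u _ h
          omega
        · have := (hc' u v huv).2.2.1 _ h he.symm
          omega
      · by_cases huv : u = v
        · subst huv; omega
        · have := mt (cycDist_eq_zero u.isLt v.isLt).1 (fun h => huv (Fin.ext h))
          omega
    · by_cases huv : u = v
      · subst huv
        have := hinj u a b (by rintro rfl; exact hab rfl) he
        omega
      · rcases hleaf u a with h | h
        · rcases hleaf v b with h' | h'
          · have := (hc' u v huv).2.2.2 _ h _ h' he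
            omega
          · have := htwo u _ h
            omega
        · omega

open PackingLetter SimpleGraph.CycleCorona in
-- Leaves of a vertex of color 1 avoid 1 and, being at mutual distance 2, have distinct colors;
-- sorting these gives the letter. At other vertices the leaf colors are dropped, which only loses
-- constraints.
theorem exists_word_of_packingColorable {n k : ℕ} (hn : 3 ≤ n)
    (h : ((SimpleGraph.cycleGraph n).generalizedCorona 3).PackingColorable k) :
    ∃ x : ℕ → PackingLetter, (∀ i < n, x i ∈ letters k) ∧
      ∀ i j, i < n → j < n → i ≠ j → Compat (cycDist n i j) (x i) (x j) := by
  obtain ⟨c, hck, hcd⟩ := h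
  have hx : ∀ u : Fin n, ∃ x ∈ letters k, x.1 = c (Sum.inl u) ∧
      ∀ j ∈ x.2, ∃ a : Fin 3, c (Sum.inr (u, a)) = j := by
    intro u
    by_cases h1 : c (Sum.inl u) = 1
    · have hne : ∀ a b : Fin 3, a ≠ b → c (Sum.inr (u, a)) ≠ c (Sum.inr (u, b)) ∧
          2 ≤ c (Sum.inr (u, a)) ∧ c (Sum.inr (u, a)) ≤ k := by
        intro a b hab
        have hr := hck (Sum.inr (u, a))
        have hv : c (Sum.inr (u, a)) ≠ 1 := by
          intro e
          have := hcd (Sum.inl u) (Sum.inr (u, a)) (by simp) (by rw [h1, e])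
          rw [lt_edist_iff hn (by simp)] at this
          simp [height, base, cycDist, h1] at this
        refine ⟨fun e => ?_, by omega, hr.2⟩
        have := hcd (Sum.inr (u, a)) (Sum.inr (u, b)) (by simpa using hab) e
        rw [lt_edist_iff hn (by simpa using hab)] at this
        simp [height, base, cycDist] at this
        omega
      have h01 := hne 0 1 (by decide)
      have h12 := hne 1 2 (by decide)
      have h20 := hne 2 0 (by decide)
      have key : ∀ a b d : Fin 3, c (Sum.inr (u, a)) < c (Sum.inr (u, b)) →
          c (Sum.inr (u, b)) < c (Sum.inr (u, d)) → 2 ≤ c (Sum.inr (u, a)) →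
          c (Sum.inr (u, d)) ≤ k → ∃ x ∈ letters k, x.1 = c (Sum.inl u) ∧
          ∀ j ∈ x.2, ∃ a : Fin 3, c (Sum.inr (u, a)) = j := by
        intro a b d hab hbd ha hd
        refine ⟨(1, [c (Sum.inr (u, a)), c (Sum.inr (u, b)), c (Sum.inr (u, d))]),
          mem_letters.2 (Or.inr ⟨_, _, _, ha, hab, hbd, hd, rfl⟩), h1.symm, ?_⟩
        intro j hj
        simp only [List.mem_cons, List.not_mem_nil, or_false] at hj
        rcases hj with rfl | rfl | rfl
        exacts [⟨_, rfl⟩, ⟨_, rfl⟩, ⟨_, rfl⟩]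
      rcases lt_or_gt_of_ne h01.1 with h | h <;> rcases lt_or_gt_of_ne h12.1 with h' | h' <;>
        rcases lt_or_gt_of_ne h20.1 with h'' | h''
      · omega
      · exact key 0 1 2 h h' h01.2.1 h20.2.2
      · exact key 2 0 1 h'' h h20.2.1 h12.2.2
      · exact key 0 2 1 h'' h' h01.2.1 h12.2.2
      · exact key 1 2 0 h' h'' h12.2.1 h01.2.2
      · exact key 1 0 2 h h'' h12.2.1 h20.2.2
      · exact key 2 1 0 h' h h20.2.1 h01.2.2
      · omega
    · have := hck (Sum.inl u)
      exact ⟨(c (Sum.inl u), []), mem_letters.2 (Or.inl ⟨_, by omega, this.2, rfl⟩), rfl, by simp⟩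
  choose x hx1 hx2 hx3 using hx
  refine ⟨fun i => if h : i < n then x ⟨i, h⟩ else (0, []), fun i hi => by simp [hi, hx1], ?_⟩
  intro i j hi hj hij
  simp only [hi, hj, dif_pos]
  have hcd' := fun a b hab he => (lt_edist_iff hn hab _).1 (hcd a b hab he)
  refine ⟨fun e => ?_, fun l hl e => ?_, fun l hl e => ?_, fun m hm l hl e => ?_⟩
  · rw [hx2, hx2] at e
    rw [hx2]
    simpa [height, base] using hcd' (Sum.inl ⟨i, hi⟩) (Sum.inl ⟨j, hj⟩) (by simpa using hij) e
  · obtain ⟨a, ha⟩ := hx3 _ l hl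
    rw [hx2] at e
    have := hcd' (Sum.inl ⟨i, hi⟩) (Sum.inr (⟨j, hj⟩, a)) (by simp) (by rw [e, ha])
    simp only [height, base] at this
    omega
  · obtain ⟨a, ha⟩ := hx3 _ l hl
    rw [hx2] at e
    have := hcd' (Sum.inr (⟨i, hi⟩, a)) (Sum.inl ⟨j, hj⟩) (by simp) (by rw [e, ha])
    simp only [height, base] at this
    omega
  · obtain ⟨a, ha⟩ := hx3 _ l hl
    obtain ⟨b, hb⟩ := hx3 _ m hm
    have := hcd' (Sum.inr (⟨i, hi⟩, b)) (Sum.inr (⟨j, hj⟩, a)) (by simp [hij]) (by rw [ha, hb, e])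
    simp only [height, base] at this
    omega

/-! ### The automaton of color counters -/

namespace PackingLetter

/-- The counter of color `j` is the number of positions that still have to pass before a cycle
vertex may receive color `j`. This is its update when `x` is read, undefined if `x` may not use
color `j`. -/
def stepColor (x : PackingLetter) (j c : ℕ) : Option ℕ :=
  bif Nat.beq x.1 j then (bif Nat.beq c 0 then some j else none)
  else bif x.2.any (Nat.beq j) then (bif Nat.ble c 1 then some (j - 1) else none)
  else some (c - 1)

/-- Update of the counters of the colors `j, j + 1, …`. -/
def step (x : PackingLetter) : ℕ → List ℕ → Option (List ℕ)
  | _, [] => some []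
  | j, c :: s => match stepColor x j c with
    | none => none
    | some c' => match step x (j + 1) s with
      | none => none
      | some s' => some (c' :: s')

theorem stepColor_eq (x : PackingLetter) (j c : ℕ) : stepColor x j c =
    if x.1 = j then (if c = 0 then some j else none)
    else if j ∈ x.2 then (if c ≤ 1 then some (j - 1) else none) else some (c - 1) := by
  have h1 : ∀ a b : ℕ, Nat.beq a b = decide (a = b) := by
    intro a b; rw [Bool.eq_iff_iff]; simp
  have h2 : ∀ a b : ℕ, Nat.ble a b = decide (a ≤ b) := by
    intro a b; rw [Bool.eq_iff_iff]; simp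
  have h3 : x.2.any (Nat.beq j) = decide (j ∈ x.2) := by
    rw [Bool.eq_iff_iff]; simp [h1]
  simp only [stepColor, h1, h2, h3, Bool.cond_decide]

theorem step_eq_some_iff (x : PackingLetter) : ∀ (j : ℕ) (s t : List ℕ), step x j s = some t ↔
    s.length = t.length ∧
      ∀ i < s.length, stepColor x (j + i) (s.getD i 0) = some (t.getD i 0) := by
  intro j s
  induction s generalizing j with
  | nil => intro t; cases t <;> simp [step]
  | cons c s ih =>
    intro t
    rw [step]
    cases hc : stepColor x j c with
    | none =>
      simp only [reduceCtorEq, false_iff, not_and]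
      intro _ h
      have := h 0 (by simp)
      simp [hc] at this
    | some c' =>
      cases hs : step x (j + 1) s with
      | none =>
        simp only [reduceCtorEq, false_iff, not_and]
        intro hl h
        cases t with
        | nil => simp at hl
        | cons d t =>
          have : step x (j + 1) s = some t := (ih (j + 1) t).2 ⟨by simpa using hl, fun i hi => by
            have := h (i + 1) (by simpa using hi)
            simpa [add_assoc, add_comm, add_left_comm] using this⟩
          rw [hs] at this
          cases this
      | some s' =>
        simp only [Option.some.injEq]
        have h1 := (ih (j + 1) s').1 hs
        constructor
        · rintro rfl
          refine ⟨by simpa using h1.1, fun i hi => ?_⟩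
          cases i with
          | zero => simpa using hc
          | succ i =>
            have := h1.2 i (by simpa using hi)
            simpa [add_assoc, add_comm, add_left_comm] using this
        · rintro ⟨hl, h⟩
          cases t with
          | nil => simp at hl
          | cons d t =>
            have h0 := h 0 (by simp)
            simp only [add_zero, List.getD_cons_zero, hc, Option.some.injEq] at h0
            have : step x (j + 1) s = some t := (ih (j + 1) t).2 ⟨by simpa using hl, fun i hi => by
              have := h (i + 1) (by simpa using hi)
              simpa [add_assoc, add_comm, add_left_comm] using this⟩
            rw [hs] at this
            rw [h0, Option.some.inj this]

/-- Read a word, starting from the state `s`. -/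
def run (s : List ℕ) : List PackingLetter → Option (List ℕ)
  | [] => some s
  | x :: w => match step x 1 s with
    | none => none
    | some t => run t w

theorem run_append {s t : List ℕ} {v : List PackingLetter} (h : run s v = some t)
    (w : List PackingLetter) : run s (v ++ w) = run t w := by
  induction v generalizing s with
  | nil => simp only [run, Option.some.injEq] at h; simp [h]
  | cons x v ih =>
    rw [run] at h
    rw [List.cons_append, run]
    cases hs : step x 1 s with
    | none => rw [hs] at h; simp at h
    | some s' => rw [hs] at h; exact ih h

theorem exists_states_of_run {s t : List ℕ} {w : List PackingLetter} (h : run s w = some t) :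
    ∃ r : ℕ → List ℕ, r 0 = s ∧ r w.length = t ∧
      ∀ i < w.length, step (w.getD i (0, [])) 1 (r i) = some (r (i + 1)) := by
  induction w generalizing s with
  | nil => exact ⟨fun _ => s, rfl, by simpa [run] using h, by simp⟩
  | cons x w ih =>
    rw [run] at h
    cases hs : step x 1 s with
    | none => rw [hs] at h; simp at h
    | some s' =>
      rw [hs] at h
      obtain ⟨r, h0, hl, hr⟩ := ih h
      refine ⟨fun i => match i with | 0 => s | i + 1 => r i, rfl, hl, fun i hi => ?_⟩
      cases i with
      | zero => simpa [h0] using hs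
      | succ i => simpa using hr i (by simpa using hi)

/-- Along a sequence of steps, any two letters are compatible. -/
theorem compat_of_steps {k : ℕ} {x : ℕ → PackingLetter} {r : ℕ → List ℕ}
    (hx : ∀ t, x t ∈ letters k) (hl : (r 0).length = k)
    (hr : ∀ t, step (x t) 1 (r t) = some (r (t + 1))) {p q : ℕ} (hpq : p < q) :
    Compat (q - p) (x p) (x q) := by
  have hlen : ∀ t, (r t).length = k := by
    intro t
    induction t with
    | zero => exact hl
    | succ t ih => rw [← ((step_eq_some_iff _ _ _ _).1 (hr t)).1, ih]
  have hc : ∀ t j, 1 ≤ j → j ≤ k →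
      stepColor (x t) j ((r t).getD (j - 1) 0) = some ((r (t + 1)).getD (j - 1) 0) := by
    intro t j h1 h2
    have := ((step_eq_some_iff _ _ _ _).1 (hr t)).2 (j - 1) (by rw [hlen]; omega)
    rwa [show 1 + (j - 1) = j by omega] at this
  -- `g t j` is the counter of color `j` before position `t`; it sits at index `j - 1` because the
  -- colors start at 1.
  generalize hg : (fun t j => (r t).getD (j - 1) 0) = g at *
  replace hc : ∀ t j, 1 ≤ j → j ≤ k → stepColor (x t) j (g t j) = some (g (t + 1) j) := by
    intro t j h1 h2
    rw [← hg]; exact hc t j h1 h2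
  simp only [stepColor_eq] at hc
  -- A counter drops by at most one per step: color `j` may be used only when its counter is 0 or 1,
  -- and any other letter just decrements it.
  have hdec : ∀ t j d, 1 ≤ j → j ≤ k → g t j ≤ g (t + d) j + d := by
    intro t j d h1 h2
    induction d with
    | zero => simp
    | succ d ih =>
      have := hc (t + d) j h1 h2
      change g t j ≤ g (t + d + 1) j + (d + 1)
      split_ifs at this <;> simp only [Option.some.injEq] at this <;> omega
  obtain ⟨d, rfl⟩ := Nat.exists_eq_add_of_lt hpq
  have hrange : ∀ t, 1 ≤ (x t).1 ∧ (x t).1 ≤ k ∧ ∀ j ∈ (x t).2, 2 ≤ j ∧ j ≤ k ∧ (x t).1 = 1 := by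
    intro t
    rcases mem_letters.1 (hx t) with ⟨j, h1, h2, h⟩ | ⟨a, b, c, h1, h2, h3, h4, h⟩
    · rw [h]; simp; omega
    · rw [h]; simp; omega
  have hv : ∀ t, g t (x t).1 = 0 ∧ g (t + 1) (x t).1 = (x t).1 := by
    intro t
    have := hc t (x t).1 (hrange t).1 (hrange t).2.1
    rw [if_pos rfl] at this
    split_ifs at this with h
    exact ⟨h, (Option.some.inj this).symm⟩
  have hlf : ∀ t, ∀ j ∈ (x t).2, g t j ≤ 1 ∧ g (t + 1) j = j - 1 := by
    intro t j hj
    have h := (hrange t).2.2 j hj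
    have := hc t j (by omega) h.2.1
    rw [if_neg (by omega), if_pos hj] at this
    split_ifs at this with h
    exact ⟨h, (Option.some.inj this).symm⟩
  have hd : ∀ j, 1 ≤ j → j ≤ k → g (p + 1) j ≤ g (p + d + 1) j + d := by
    intro j h1 h2
    have := hdec (p + 1) j d h1 h2
    rwa [show p + 1 + d = p + d + 1 by ring] at this
  have hp := hrange p
  have hq := hrange (p + d + 1)
  have hvp := hv p
  have hvq := hv (p + d + 1)
  refine ⟨fun e => ?_, fun j hj e => ?_, fun j hj e => ?_, fun i hi j hj e => ?_⟩
  · have := hd (x p).1 hp.1 hp.2.1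
    rw [← e] at hvq
    omega
  · have := hd (x p).1 hp.1 hp.2.1
    have := hlf (p + d + 1) j hj
    rw [← e] at this
    omega
  · have := hp.2.2 j hj
    have := hd j (by omega) (by omega)
    have := hlf p j hj
    rw [e] at hvq
    omega
  · subst e
    have := hp.2.2 i hi
    have := hd i (by omega) (by omega)
    have := hlf p i hi
    have := hlf (p + d + 1) i hj
    omega

/-- A closed run of length at least `3` gives a packing coloring. -/
theorem packingColorable_of_run {k : ℕ} {s : List ℕ} {w : List PackingLetter}
    (hn : 3 ≤ w.length) (hk : 1 ≤ k) (hs : s.length = k) (hw : ∀ x ∈ w, x ∈ letters k)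
    (h : run s w = some s) :
    ((SimpleGraph.cycleGraph w.length).generalizedCorona 3).PackingColorable k := by
  obtain ⟨r, h0, hl, hr⟩ := exists_states_of_run h
  have hpos : 0 < w.length := by omega
  set n := w.length with hn'
  have hmem : ∀ i < n, w.getD i (0, []) ∈ letters k := by
    intro i hi
    rw [List.getD_eq_getElem _ _ hi]
    exact hw _ (List.getElem_mem _)
  have hper : ∀ {p q : ℕ}, p < q → Compat (q - p) (w.getD (p % n) (0, [])) (w.getD (q % n) (0, [])) := by
    intro p q
    refine compat_of_steps (k := k) (x := fun t => w.getD (t % n) (0, []))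
      (r := fun t => r (t % n)) (fun t => hmem _ (Nat.mod_lt _ hpos)) (by simp [h0, hs]) ?_
    intro t
    have h1 := hr (t % n) (Nat.mod_lt _ hpos)
    simp only [h1]
    by_cases h2 : t % n + 1 = n
    · rw [h2, hl, ← h0, ← Nat.mod_add_mod, h2, Nat.mod_self]
    · have := Nat.mod_lt t hpos
      rw [← Nat.mod_add_mod t, Nat.mod_eq_of_lt (by omega : t % n + 1 < n)]
  refine packingColorable_of_word hn hk (fun i => w.getD i (0, [])) hmem ?_
  intro i j hij hj
  rw [cycDist_of_lt hij]
  -- The shorter arc runs either from `i` to `j` or from `j` to `i + n`; both are stretches of the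
  -- periodic word.
  rcases min_choice (j - i) (n - (j - i)) with h | h <;> rw [h]
  · have := hper hij
    rwa [Nat.mod_eq_of_lt hj, Nat.mod_eq_of_lt (hij.trans hj)] at this
  · have := hper (show j < i + n by omega)
    rw [Nat.mod_eq_of_lt hj, Nat.add_mod_right, Nat.mod_eq_of_lt (hij.trans hj),
      show i + n - j = n - (j - i) by omega] at this
    exact this.symm

/-! ### From colorings to periodic runs -/

/-- The counter of color `j` before position `t` of the word `x`. -/
def counter (x : ℕ → PackingLetter) (j : ℕ) : ℕ → ℕ
  | 0 => 0
  | t + 1 => if (x t).1 = j then j else if j ∈ (x t).2 then j - 1 else counter x j t - 1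

/-- The state before position `t` of the word `x`. -/
def state (k : ℕ) (x : ℕ → PackingLetter) (t : ℕ) : List ℕ :=
  (List.range k).map fun i => counter x (i + 1) t

/-- A nonzero counter stems from a use of `j` and has only ticked down since. It thus exhibits an
earlier position to which `Compat` can be applied. -/
theorem counter_eq_zero_or (x : ℕ → PackingLetter) (j t : ℕ) : counter x j t = 0 ∨
    ∃ p, (p < t ∧ (x p).1 = j ∧ counter x j t + (t - 1 - p) = j) ∨
      p < t ∧ j ∈ (x p).2 ∧ counter x j t + (t - 1 - p) = j - 1 := by
  induction t with
  | zero => simp [counter]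
  | succ t ih =>
    rw [counter]
    split_ifs with h1 h2
    · exact Or.inr ⟨t, Or.inl ⟨by omega, h1, by omega⟩⟩
    · exact Or.inr ⟨t, Or.inr ⟨by omega, h2, by omega⟩⟩
    · by_cases h0 : counter x j t - 1 = 0
      · exact Or.inl h0
      · right
        rcases ih with ih | ⟨p, ⟨hp, h3, h4⟩ | ⟨hp, h3, h4⟩⟩
        · omega
        · exact ⟨p, Or.inl ⟨by omega, h3, by omega⟩⟩
        · exact ⟨p, Or.inr ⟨by omega, h3, by omega⟩⟩

theorem step_state {k : ℕ} {x : ℕ → PackingLetter}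
    (hc : ∀ p q, p < q → Compat (q - p) (x p) (x q)) (t : ℕ) :
    step (x t) 1 (state k x t) = some (state k x (t + 1)) := by
  rw [step_eq_some_iff]
  refine ⟨by simp [state], fun i hi => ?_⟩
  have hi' : i < k := by simpa [state] using hi
  have hg : ∀ t, (state k x t).getD i 0 = counter x (i + 1) t := by
    intro t; simp [state, hi']
  rw [hg, hg, stepColor_eq, counter, add_comm 1 i]
  have hcnt := counter_eq_zero_or x (i + 1) t
  by_cases h1 : (x t).1 = i + 1
  · rw [if_pos h1, if_pos h1, if_pos]
    rcases hcnt with h | ⟨p, ⟨hp, h3, h4⟩ | ⟨hp, h3, h4⟩⟩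
    · exact h
    · have := (hc p t hp).1 (by omega); omega
    · have := (hc p t hp).2.2.1 _ h3 h1; omega
  · rw [if_neg h1, if_neg h1]
    by_cases h2 : i + 1 ∈ (x t).2
    · rw [if_pos h2, if_pos h2, if_pos]
      rcases hcnt with h | ⟨p, ⟨hp, h3, h4⟩ | ⟨hp, h3, h4⟩⟩
      · omega
      · have := (hc p t hp).2.1 _ h2 h3; omega
      · have := (hc p t hp).2.2.2 _ h3 _ h2 rfl; omega
    · rw [if_neg h2, if_neg h2]

theorem state_zero (k : ℕ) (x : ℕ → PackingLetter) : state k x 0 = List.replicate k 0 := by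
  simp [state, counter, List.map_const']

theorem state_add_period {k n : ℕ} {x : ℕ → PackingLetter} (hx : ∀ t, x (t + n) = x t) (t : ℕ)
    (ht : k ≤ t) : state k x (t + n) = state k x t := by
  -- Reading the same letters, the two counters merge at the first use of `j`; until then both count
  -- down from values at most `j`, so they are 0 by time `j`.
  have key : ∀ j t, counter x j (t + n) = counter x j t ∨
      counter x j (t + n) + t ≤ j ∧ counter x j t + t ≤ j := by
    intro j t
    induction t with
    | zero =>
      right
      refine ⟨?_, by simp [counter]⟩
      rcases counter_eq_zero_or x j (0 + n) with h | ⟨p, ⟨hp, h3, h4⟩ | ⟨hp, h3, h4⟩⟩ <;> omega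
    | succ t ih =>
      rw [add_right_comm, counter, counter, hx]
      split_ifs
      · left; rfl
      · left; rfl
      · omega
  unfold state
  refine List.map_congr_left fun i hi => ?_
  rw [List.mem_range] at hi
  have := key (i + 1) t
  omega

/-- A packing coloring with `k` colors of the corona of a cycle of length more than `k` gives a
periodic infinite run. -/
theorem exists_periodic_word {n k : ℕ} (hn : 3 ≤ n) (hk : k < n)
    (h : ((SimpleGraph.cycleGraph n).generalizedCorona 3).PackingColorable k) :
    ∃ x : ℕ → PackingLetter, (∀ t, x t ∈ letters k) ∧ (∀ t, x (t + n) = x t) ∧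
      ∀ t, step (x t) 1 (state k x t) = some (state k x (t + 1)) := by
  obtain ⟨y, hy, hc⟩ := exists_word_of_packingColorable hn h
  have hpos : 0 < n := by omega
  refine ⟨fun t => y (t % n), fun t => hy _ (Nat.mod_lt _ hpos), fun t => by simp, ?_⟩
  refine step_state fun p q hpq => ?_
  have hp := Nat.mod_lt p hpos
  have hq := Nat.mod_lt q hpos
  -- Beyond distance `k` every pair of letters is compatible. Otherwise `q - p < n`, so the residues
  -- differ and their cycle distance is at most `q - p`.
  rcases lt_or_ge k (q - p) with hd | hd
  · exact compat_of_lt (hy _ hq) (hy _ hp) hd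
  · have hqp : q % n = (p % n + (q - p)) % n := by
      rw [Nat.mod_add_mod]; congr 1; omega
    rcases lt_or_ge (p % n + (q - p)) n with h1 | h1
    · rw [Nat.mod_eq_of_lt h1] at hqp
      refine (hc _ _ hp hq (by omega)).mono ?_
      unfold cycDist; omega
    · rw [Nat.mod_eq_sub_mod h1, Nat.mod_eq_of_lt (by omega : p % n + (q - p) - n < n)] at hqp
      refine (hc _ _ hp hq (by omega)).mono ?_
      unfold cycDist; omega

/-! ### Certificates for reachability and first returns -/

/-- Equality of lists of natural numbers. -/
def eqState : List ℕ → List ℕ → Bool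
  | [], [] => true
  | a :: s, b :: t => Nat.beq a b && eqState s t
  | _, _ => false

theorem eqState_iff : ∀ s t : List ℕ, eqState s t = true ↔ s = t
  | [], [] => by simp [eqState]
  | a :: s, b :: t => by simp [eqState, eqState_iff s t]
  | [], _ :: _ => by simp [eqState]
  | _ :: _, [] => by simp [eqState]

/-- Depth-first search for the states outside `F` that are reachable from `s`, in reverse
postorder. -/
def visit (L : List PackingLetter) (F : List (List ℕ)) :
    ℕ → List ℕ → List (List ℕ) → List (List ℕ)
  | 0, _, acc => acc
  | fuel + 1, s, acc => bif F.any (eqState s) then acc else bif acc.any (eqState s) then acc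
    else s :: L.foldr (fun x acc => match step x 1 s with
      | none => acc
      | some t => visit L F fuel t acc) acc

/-- Every successor of a state in the list is in `F` or later in the list. -/
def topological (L : List PackingLetter) (F : List (List ℕ)) : List (List ℕ) → Bool
  | [] => true
  | s :: l => (L.all fun x => match step x 1 s with
      | none => true
      | some t => F.any (eqState t) || l.any (eqState t)) && topological L F l

/-- Outside `F` a run can only move forward in the finite list `S`, so it must enter `F`. Nothing
about how `S` was found is needed, so `visit` requires no correctness proof. -/
theorem exists_mem_of_topological {L : List PackingLetter} {F : List (List ℕ)}
    {x : ℕ → PackingLetter} {r : ℕ → List ℕ} (hx : ∀ t, x t ∈ L)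
    (hr : ∀ t, step (x t) 1 (r t) = some (r (t + 1))) {S : List (List ℕ)}
    (hS : topological L F S = true) {t : ℕ} (ht : r t ∈ S) : ∃ u, t ≤ u ∧ r u ∈ F := by
  induction S generalizing t with
  | nil => simp at ht
  | cons s l ih =>
    rw [topological, Bool.and_eq_true, List.all_eq_true] at hS
    rcases List.mem_cons.1 ht with h | h
    · have h1 := hS.1 (x t) (hx t)
      rw [← h, hr t] at h1
      simp only [Bool.or_eq_true, List.any_eq_true, eqState_iff, exists_eq_right'] at h1
      rcases h1 with h1 | h1
      · exact ⟨t + 1, by omega, h1⟩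
      · obtain ⟨u, h2, h3⟩ := ih hS.2 h1
        exact ⟨u, by omega, h3⟩
    · exact ih hS.2 h

/-- Every run from `s` reaches a state `t ∈ F` within `fuel` steps, and if it does so for the first
time after `e` steps, then `d + e ∈ g t`. -/
def returns (L : List PackingLetter) (F : List (List ℕ)) (g : List ℕ → List ℕ) :
    ℕ → ℕ → List ℕ → Bool
  | 0, _, _ => false
  | fuel + 1, d, s => L.all fun x => match step x 1 s with
    | none => true
    | some t => bif F.any (eqState t) then (g t).any (Nat.beq (d + 1))
      else returns L F g fuel (d + 1) t

theorem exists_return {L : List PackingLetter} {F : List (List ℕ)} {g : List ℕ → List ℕ}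
    {x : ℕ → PackingLetter} {r : ℕ → List ℕ} (hx : ∀ t, x t ∈ L)
    (hr : ∀ t, step (x t) 1 (r t) = some (r (t + 1))) :
    ∀ (fuel d t : ℕ), returns L F g fuel d (r t) = true →
      ∃ e, 0 < e ∧ r (t + e) ∈ F ∧ d + e ∈ g (r (t + e)) ∧ ∀ i, 0 < i → i < e → r (t + i) ∉ F := by
  intro fuel
  induction fuel with
  | zero => intro d t h; simp [returns] at h
  | succ fuel ih =>
    intro d t h
    rw [returns, List.all_eq_true] at h
    have h := h (x t) (hx t)
    rw [hr t] at h
    simp only at h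
    have hany : F.any (eqState (r (t + 1))) = true ↔ r (t + 1) ∈ F := by simp [eqState_iff]
    cases hF : F.any (eqState (r (t + 1))) with
    | true =>
      rw [hF, cond_true] at h
      refine ⟨1, one_pos, hany.1 hF, ?_, fun i h1 h2 => by omega⟩
      simpa using h
    | false =>
      rw [hF, cond_false] at h
      obtain ⟨e, he, h1, h2, h3⟩ := ih (d + 1) (t + 1) h
      refine ⟨e + 1, by omega, ?_, ?_, ?_⟩
      · rwa [show t + (e + 1) = t + 1 + e by ring]
      · rwa [show t + (e + 1) = t + 1 + e by ring, show d + (e + 1) = d + 1 + e by ring]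
      · intro i hi hie
        rcases Nat.lt_or_ge 1 i with h4 | h4
        · have := h3 (i - 1) (by omega) (by omega)
          rwa [show t + 1 + (i - 1) = t + i by omega] at this
        · rw [show i = 1 by omega, ← hany, hF]
          simp

/-- If the lengths of first returns between states of `F` are in `g`, and `D` contains `0` at the
state at time `t` and is closed under adding lengths of first returns, then the length of every run
from time `t` to a state in `F` is in `D`. -/
theorem mem_lengths {L : List PackingLetter} {F : List (List ℕ)} {g : List ℕ → List ℕ → List ℕ}
    {D : List ℕ → List ℕ} {N fuel : ℕ}
    {x : ℕ → PackingLetter} {r : ℕ → List ℕ} (hx : ∀ t, x t ∈ L)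
    (hr : ∀ t, step (x t) 1 (r t) = some (r (t + 1)))
    (hg : ∀ s ∈ F, returns L F (g s) fuel 0 s = true)
    (hD : ∀ s ∈ F, ∀ u ∈ F, ∀ m ∈ D s, ∀ d ∈ g s u, m + d ≤ N → m + d ∈ D u)
    {t n : ℕ} (h0 : 0 ∈ D (r t)) (ht : r t ∈ F) (hn : r (t + n) ∈ F) (hnN : n ≤ N) :
    n ∈ D (r (t + n)) := by
  have key : ∀ k h, k + h = n → h ∈ D (r (t + h)) → r (t + h) ∈ F → n ∈ D (r (t + n)) := by
    intro k
    induction k using Nat.strong_induction_on with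
    | _ k ih =>
      intro h hk hh hF
      rcases Nat.eq_zero_or_pos k with rfl | hpos
      · rw [zero_add] at hk
        rwa [← hk]
      · obtain ⟨e, he, h1, h2, h3⟩ := exists_return hx hr fuel 0 (t + h) (hg _ hF)
        -- A first return cannot jump over time `t + n`, since the state there lies in `F`.
        rcases Nat.lt_or_ge k e with hke | hke
        · refine absurd ?_ (h3 k hpos hke)
          rwa [show t + h + k = t + n by omega]
        · rw [zero_add] at h2
          have := hD _ hF _ h1 h hh e h2 (by omega)
          rw [show t + h + e = t + (h + e) by ring] at h1 this
          exact ih (k - e) (by omega) (h + e) (by omega) this h1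
  exact key n 0 (by simp) (by simpa using h0) (by simpa using ht)

/-! ### Lower bounds -/

/-- The two states that every infinite run with six colors visits. -/
def hubs : List (List ℕ) := [[0, 0, 1, 2, 3, 6], [0, 0, 1, 2, 5, 4]]

/-- The lengths of the first returns from one hub to another. -/
def gaps (s t : List ℕ) : List ℕ :=
  bif eqState s t then [14, 23, 28, 29]
  else bif eqState s [0, 0, 1, 2, 3, 6] then [18, 19, 23, 24, 25] else [19, 33]

/-- The state before the first position. -/
def initialState (k : ℕ) : List ℕ := List.replicate k 0

theorem exists_topological_six : ∃ S, topological (letters 6) hubs S = true ∧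
    S.any (eqState (initialState 6)) = true :=
  ⟨visit (letters 6) hubs 40 (initialState 6) [], by decide +kernel, by decide +kernel⟩

/-- With an empty target set, such an ordering says that no infinite run starts at the initial
state. -/
theorem exists_topological_five : ∃ S, topological (letters 5) [] S = true ∧
    S.any (eqState (initialState 5)) = true :=
  ⟨visit (letters 5) [] 10 (initialState 5) [], by decide +kernel, by decide +kernel⟩

/-- Every hub-avoiding run from a hub dies or returns within 40 steps, so the enumeration is
exhaustive. -/
theorem returns_hubs : ∀ s ∈ hubs, returns (letters 6) hubs (gaps s) 40 0 s = true := by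
  decide +kernel

/-- The lengths at most `91` of closed runs from a hub to itself. -/
def loopLengths : List ℕ :=
  [0, 14, 23, 28, 29, 37, 38, 42, 43, 44, 46, 51, 52, 56, 57, 58, 60, 61, 65, 66, 67, 69, 70, 71,
    72, 73, 74, 75, 76, 79, 80, 81, 82, 83, 84, 85, 86, 87, 88, 89, 90]

/-- The lengths at most `91` of runs from the first hub to any hub. -/
def lengthsFromFst (s : List ℕ) : List ℕ :=
  bif eqState s [0, 0, 1, 2, 3, 6] then loopLengths else
    [18, 19, 23, 24, 25, 32, 33, 37, 38, 39, 41, 42, 46, 47, 48, 51, 52, 53, 54, 55, 56, 57, 60, 61,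
      62, 63, 64, 65, 66, 67, 68, 69, 70, 71, 74, 75, 76, 77, 78, 79, 80, 81, 82, 83, 84, 85, 86,
      87, 88, 89, 90, 91]

/-- The lengths at most `91` of runs from the second hub to any hub. -/
def lengthsFromSnd (s : List ℕ) : List ℕ :=
  bif eqState s [0, 0, 1, 2, 5, 4] then loopLengths else
    [19, 33, 42, 47, 48, 56, 57, 61, 62, 63, 65, 70, 71, 75, 76, 77, 79, 80, 84, 85, 86, 88, 89, 90,
      91]

/-- Closure makes the lists contain all actual run lengths up to 91, the largest exceptional length;
the lower bound needs no converse. -/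
theorem lengthsFromFst_closed : ∀ s ∈ hubs, ∀ u ∈ hubs, ∀ m ∈ lengthsFromFst s, ∀ d ∈ gaps s u,
    m + d ≤ 91 → m + d ∈ lengthsFromFst u := by decide +kernel

theorem lengthsFromSnd_closed : ∀ s ∈ hubs, ∀ u ∈ hubs, ∀ m ∈ lengthsFromSnd s, ∀ d ∈ gaps s u,
    m + d ≤ 91 → m + d ∈ lengthsFromSnd u := by decide +kernel

/-- The periodic run visits a hub at arbitrarily late times, and is in the same state `n` positions
later; so one period is a closed run through that hub. -/
theorem mem_loopLengths {n : ℕ} (hn : 7 ≤ n) (hN : n ≤ 91)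
    (h : ((SimpleGraph.cycleGraph n).generalizedCorona 3).PackingColorable 6) :
    n ∈ loopLengths := by
  obtain ⟨x, hx, hper, hr⟩ := exists_periodic_word (by omega) (by omega) h
  obtain ⟨S, hS, h0⟩ := exists_topological_six
  have hF : ∀ t, ∃ u, t ≤ u ∧ state 6 x u ∈ hubs := by
    intro t
    induction t with
    | zero =>
      refine exists_mem_of_topological hx hr hS ?_
      rw [state_zero]
      simpa [eqState_iff, initialState] using h0
    | succ t ih =>
      obtain ⟨u, h1, h2⟩ := ih
      obtain ⟨e, he, h3, -⟩ := exists_return hx hr 40 0 u (returns_hubs _ h2)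
      exact ⟨u + e, by omega, h3⟩
  -- From time 6 on, the initial state is forgotten and the states are periodic.
  obtain ⟨t, ht, htF⟩ := hF 6
  have hloop := state_add_period hper t ht
  have h1 := fun D hD h0 => mem_lengths (D := D) (N := 91) (n := n) hx hr returns_hubs hD h0 htF
    (by rwa [hloop]) hN
  rw [hloop] at h1
  simp only [hubs, List.mem_cons, List.not_mem_nil, or_false] at htF
  rcases htF with h2 | h2 <;> rw [h2] at h1
  · exact h1 lengthsFromFst lengthsFromFst_closed (by decide)
  · exact h1 lengthsFromSnd lengthsFromSnd_closed (by decide)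

theorem not_packingColorable_five_of_lt {n : ℕ} (hn : 5 < n) :
    ¬ ((SimpleGraph.cycleGraph n).generalizedCorona 3).PackingColorable 5 := by
  intro h
  obtain ⟨x, hx, -, hr⟩ := exists_periodic_word (by omega) hn h
  obtain ⟨S, hS, h0⟩ := exists_topological_five
  obtain ⟨u, -, hu⟩ := exists_mem_of_topological (t := 0) hx hr hS (by
    rw [state_zero]
    simpa [eqState_iff, initialState] using h0)
  simp at hu

/-- Here and in the next two cases the number of colors equals `n`, so `exists_periodic_word` does
not apply; all words are searched, with compatibility tested letter by letter to prune. -/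
theorem not_packingColorable_three_three :
    ¬ ((SimpleGraph.cycleGraph 3).generalizedCorona 3).PackingColorable 3 := by
  intro h
  obtain ⟨x, hx, hc⟩ := exists_word_of_packingColorable le_rfl h
  have key : ∀ a ∈ letters 3, ∀ b ∈ letters 3, Compat 1 a b → ∀ c ∈ letters 3,
      Compat 1 a c → Compat 1 b c → False := by decide +kernel
  exact key (x 0) (hx 0 (by simp)) (x 1) (hx 1 (by simp)) (hc 0 1 (by simp) (by simp) (by simp))
    (x 2) (hx 2 (by simp)) (hc 0 2 (by simp) (by simp) (by simp))
    (hc 1 2 (by simp) (by simp) (by simp))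

theorem not_packingColorable_four_four :
    ¬ ((SimpleGraph.cycleGraph 4).generalizedCorona 3).PackingColorable 4 := by
  intro h
  obtain ⟨x, hx, hc⟩ := exists_word_of_packingColorable (by simp) h
  have key : ∀ a ∈ letters 4, ∀ b ∈ letters 4, Compat 1 a b → ∀ c ∈ letters 4,
      Compat 2 a c → Compat 1 b c → ∀ d ∈ letters 4, Compat 1 a d → Compat 2 b d →
      Compat 1 c d → False := by decide +kernel
  exact key (x 0) (hx 0 (by simp)) (x 1) (hx 1 (by simp)) (hc 0 1 (by simp) (by simp) (by simp))
    (x 2) (hx 2 (by simp)) (hc 0 2 (by simp) (by simp) (by simp))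
    (hc 1 2 (by simp) (by simp) (by simp))
    (x 3) (hx 3 (by simp)) (hc 0 3 (by simp) (by simp) (by simp))
    (hc 1 3 (by simp) (by simp) (by simp)) (hc 2 3 (by simp) (by simp) (by simp))

theorem not_packingColorable_five_five :
    ¬ ((SimpleGraph.cycleGraph 5).generalizedCorona 3).PackingColorable 5 := by
  intro h
  obtain ⟨x, hx, hc⟩ := exists_word_of_packingColorable (by simp) h
  have key : ∀ a ∈ letters 5, ∀ b ∈ letters 5, Compat 1 a b → ∀ c ∈ letters 5,
      Compat 2 a c → Compat 1 b c → ∀ d ∈ letters 5, Compat 2 a d → Compat 2 b d →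
      Compat 1 c d → ∀ e ∈ letters 5, Compat 1 a e → Compat 2 b e → Compat 2 c e → Compat 1 d e →
      False := by decide +kernel
  exact key (x 0) (hx 0 (by simp)) (x 1) (hx 1 (by simp)) (hc 0 1 (by simp) (by simp) (by simp))
    (x 2) (hx 2 (by simp)) (hc 0 2 (by simp) (by simp) (by simp))
    (hc 1 2 (by simp) (by simp) (by simp))
    (x 3) (hx 3 (by simp)) (hc 0 3 (by simp) (by simp) (by simp))
    (hc 1 3 (by simp) (by simp) (by simp)) (hc 2 3 (by simp) (by simp) (by simp))
    (x 4) (hx 4 (by simp)) (hc 0 4 (by simp) (by simp) (by simp))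
    (hc 1 4 (by simp) (by simp) (by simp)) (hc 2 4 (by simp) (by simp) (by simp))
    (hc 3 4 (by simp) (by simp) (by simp))

/-! ### Upper bounds from explicit closed words -/

/-- Words written as lists of numbers: `j < 10` stands for the letter `(j, [])`, and a number with
the digits `a`, `b`, `c` for `(1, [a, b, c])`. -/
def decode (m : ℕ) : PackingLetter :=
  if m < 10 then (m, []) else (1, [m / 100, m / 10 % 10, m % 10])

/-- There is a closed run of length `n` from `s` to itself. -/
def HasLoop (k : ℕ) (s : List ℕ) (n : ℕ) : Prop :=
  ∃ w : List PackingLetter, w.length = n ∧ (∀ x ∈ w, x ∈ letters k) ∧ run s w = some s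

theorem HasLoop.zero (k : ℕ) (s : List ℕ) : HasLoop k s 0 := ⟨[], rfl, by simp, rfl⟩

theorem HasLoop.add {k m n : ℕ} {s : List ℕ} (hm : HasLoop k s m) (hn : HasLoop k s n) :
    HasLoop k s (m + n) := by
  obtain ⟨v, h1, h2, h3⟩ := hm
  obtain ⟨w, h4, h5, h6⟩ := hn
  refine ⟨v ++ w, by simp [h1, h4], fun x hx => ?_, by rw [run_append h3, h6]⟩
  rcases List.mem_append.1 hx with h | h
  exacts [h2 x h, h5 x h]

theorem HasLoop.mul {k n : ℕ} {s : List ℕ} (h : HasLoop k s n) (a : ℕ) : HasLoop k s (a * n) := by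
  induction a with
  | zero => rw [zero_mul]; exact HasLoop.zero k s
  | succ a ih => rw [Nat.succ_mul]; exact ih.add h

theorem HasLoop.packingColorable {k n : ℕ} {s : List ℕ} (h : HasLoop k s n) (hn : 3 ≤ n)
    (hk : 1 ≤ k) (hs : s.length = k) :
    ((SimpleGraph.cycleGraph n).generalizedCorona 3).PackingColorable k := by
  obtain ⟨w, rfl, h2, h3⟩ := h
  exact packingColorable_of_run hn hk hs h2 h3

theorem hasLoop_of_decode {k : ℕ} {s : List ℕ} (w : List ℕ)
    (h : (∀ m ∈ w, decode m ∈ letters k) ∧ run s (w.map decode) = some s) :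
    HasLoop k s w.length :=
  ⟨w.map decode, by simp, by simpa using h.1, h.2⟩

theorem hasLoop_seven {n : ℕ} (hn : 7 ≤ n) : HasLoop 7 [0, 1, 1, 1, 0, 6, 0] n := by
  have h7 : HasLoop 7 [0, 1, 1, 1, 0, 6, 0] 7 :=
    hasLoop_of_decode [237, 5, 2, 4, 3, 2, 6] (by decide +kernel)
  induction n using Nat.strong_induction_on with
  | _ n ih =>
    rcases Nat.lt_or_ge n 14 with h | h
    -- Loops of the seven consecutive lengths 7 to 13 at one common state suffice, since the loop of
    -- length 7 can be appended repeatedly.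
    · interval_cases n
      · exact h7
      · exact hasLoop_of_decode [7, 3, 5, 2, 4, 3, 2, 6] (by decide +kernel)
      · exact hasLoop_of_decode [7, 2, 3, 5, 2, 4, 3, 2, 6] (by decide +kernel)
      · exact hasLoop_of_decode [7, 4, 2, 3, 5, 2, 4, 3, 2, 6] (by decide +kernel)
      · exact hasLoop_of_decode [235, 4, 2, 7, 3, 5, 2, 4, 3, 2, 6] (by decide +kernel)
      · exact hasLoop_of_decode [5, 2, 3, 4, 2, 367, 5, 2, 4, 3, 2, 6] (by decide +kernel)
      · exact hasLoop_of_decode [5, 2, 3, 4, 2, 7, 3, 5, 2, 4, 3, 2, 6] (by decide +kernel)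
    · have := (ih (n - 7) (by omega) (by omega)).add h7
      rwa [Nat.sub_add_cancel (by omega)] at this

/-- The cycle lengths at least `7` for which six colors do not suffice. -/
def exceptionalLengths : Finset ℕ :=
  Finset.Icc 7 13 ∪ Finset.Icc 15 22 ∪ Finset.Icc 24 27 ∪ Finset.Icc 30 36 ∪
    {39, 40, 41} ∪ {45} ∪ Finset.Icc 47 50 ∪ {53, 54, 55, 59, 62, 63, 64, 68, 77, 78, 91}

theorem exceptionalLengths_spec : ∀ n ∈ exceptionalLengths, 7 ≤ n ∧ n ≤ 91 ∧ n ∉ loopLengths := by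
  decide +kernel

/-- The generators 14, 23 and 29 are first returns to the first hub; 38 = 19 + 19 and 44 = 25 + 19
are detours through the second. The remaining first return 28 is 14 + 14. -/
theorem exists_combination : ∀ n < 106, 7 ≤ n → n ∉ exceptionalLengths →
    ∃ a < 8, ∃ b < 5, ∃ c < 4, ∃ d < 3, ∃ e < 2, a * 14 + b * 23 + c * 29 + d * 38 + e * 44 = n := by
  decide +kernel

theorem hasLoop_six {n : ℕ} (hn : 7 ≤ n) (hE : n ∉ exceptionalLengths) :
    HasLoop 6 [0, 0, 1, 2, 3, 6] n := by
  have h14 : HasLoop 6 [0, 0, 1, 2, 3, 6] 14 :=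
    hasLoop_of_decode [2, 3, 4, 2, 5, 3, 6, 2, 4, 3, 2, 5, 234, 6] (by decide +kernel)
  induction n using Nat.strong_induction_on with
  | _ n ih =>
    -- From 106 = 92 + 14 on, `n - 14` exceeds the largest exceptional length 91.
    rcases Nat.lt_or_ge n 106 with h | h
    · have h23 : HasLoop 6 [0, 0, 1, 2, 3, 6] 23 :=
        hasLoop_of_decode [2, 3, 4, 2, 5, 3, 2, 4, 6, 2, 3, 5, 4, 2, 3, 6, 2, 4, 3, 2, 5, 234, 6]
          (by decide +kernel)
      have h29 : HasLoop 6 [0, 0, 1, 2, 3, 6] 29 :=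
        hasLoop_of_decode [2, 3, 4, 2, 5, 3, 2, 6, 4, 2, 3, 5, 2, 4, 6, 2, 3, 5, 4, 2, 3, 6, 2, 4,
          3, 2, 5, 234, 6] (by decide +kernel)
      have h38 : HasLoop 6 [0, 0, 1, 2, 3, 6] 38 :=
        hasLoop_of_decode [2, 3, 4, 2, 5, 3, 2, 4, 6, 2, 3, 5, 2, 4, 3, 2, 6, 234, 5, 2, 3, 4, 2, 6,
          3, 2, 4, 5, 2, 3, 6, 2, 4, 3, 2, 5, 234, 6] (by decide +kernel)
      have h44 : HasLoop 6 [0, 0, 1, 2, 3, 6] 44 :=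
        hasLoop_of_decode [2, 3, 4, 2, 5, 3, 2, 6, 4, 2, 3, 5, 2, 4, 6, 2, 3, 5, 2, 4, 3, 2, 6, 234,
          5, 2, 3, 4, 2, 6, 3, 2, 4, 5, 2, 3, 6, 2, 4, 3, 2, 5, 234, 6] (by decide +kernel)
      obtain ⟨a, -, b, -, c, -, d, -, e, -, rfl⟩ := exists_combination n h hn hE
      exact ((((h14.mul a).add (h23.mul b)).add (h29.mul c)).add (h38.mul d)).add (h44.mul e)
    · have := (ih (n - 14) (by omega) (by omega) (fun h' => by
        have := exceptionalLengths_spec _ h'; omega)).add h14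
      rwa [Nat.sub_add_cancel (by omega)] at this

theorem packingColorable_of_decode {n k : ℕ} (w : List ℕ) (hn : 3 ≤ n) (hk : 1 ≤ k)
    (h : (∀ i < n, decode (w.getD i 0) ∈ letters k) ∧ ∀ j < n, ∀ i < j,
      Compat (cycDist n i j) (decode (w.getD i 0)) (decode (w.getD j 0))) :
    ((SimpleGraph.cycleGraph n).generalizedCorona 3).PackingColorable k :=
  packingColorable_of_word hn hk (fun i => decode (w.getD i 0)) h.1
    fun i j hij hj => h.2 j hj i hij

end PackingLetter

/-! ### The packing chromatic number -/

namespace SimpleGraph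

variable {V : Type*} {G : SimpleGraph V}

theorem PackingColorable.mono {k l : ℕ} (h : G.PackingColorable k) (hkl : k ≤ l) :
    G.PackingColorable l := by
  obtain ⟨c, h1, h2⟩ := h
  exact ⟨c, fun v => ⟨(h1 v).1, (h1 v).2.trans hkl⟩, h2⟩

theorem packingChromaticNumber_eq_succ {k : ℕ} (h : G.PackingColorable (k + 1))
    (h' : ¬ G.PackingColorable k) : G.packingChromaticNumber = (k + 1 : ℕ) := by
  refine le_antisymm (iInf₂_le (k + 1) h) (le_iInf₂ fun l hl => ?_)
  have : k + 1 ≤ l := by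
    by_contra hlt
    exact h' (PackingColorable.mono hl (by omega))
  exact_mod_cast this

end SimpleGraph

open PackingLetter in
/-- The packing chromatic number of the generalized corona `C_n ⊙ 3K₁` for every `n ≥ 3`. -/
theorem mainTheorem8 (n : ℕ) (hn : 3 ≤ n) :
    ((SimpleGraph.cycleGraph n).generalizedCorona 3).packingChromaticNumber =
      if n = 3 then 4
      else if n = 4 then 5
      else if n ∈ Finset.Icc 7 13 ∪ Finset.Icc 15 22 ∪ Finset.Icc 24 27 ∪ Finset.Icc 30 36 ∪
          {39, 40, 41} ∪ {45} ∪ Finset.Icc 47 50 ∪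
          {53, 54, 55, 59, 62, 63, 64, 68, 77, 78, 91} then 7
      else 6 := by
  change _ = if n = 3 then 4 else if n = 4 then 5 else if n ∈ exceptionalLengths then 7 else 6
  split_ifs with h3 h4 hE
  · subst h3
    exact SimpleGraph.packingChromaticNumber_eq_succ
      (packingColorable_of_decode [2, 3, 4] le_rfl (by simp) (by decide +kernel))
      not_packingColorable_three_three
  · subst h4
    exact SimpleGraph.packingChromaticNumber_eq_succ
      (packingColorable_of_decode [2, 3, 4, 5] (by simp) (by simp) (by decide +kernel))
      not_packingColorable_four_four
  · have hspec := exceptionalLengths_spec n hE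
    exact SimpleGraph.packingChromaticNumber_eq_succ
      ((hasLoop_seven hspec.1).packingColorable hn (by simp) rfl)
      fun h => hspec.2.2 (mem_loopLengths hspec.1 hspec.2.1 h)
  · refine SimpleGraph.packingChromaticNumber_eq_succ ?_ ?_
    · rcases Nat.lt_or_ge n 7 with h | h
      · obtain rfl | rfl : n = 5 ∨ n = 6 := by omega
        · exact packingColorable_of_decode [2, 3, 4, 5, 6] (by simp) (by simp) (by decide +kernel)
        · exact packingColorable_of_decode [2, 3, 4, 2, 5, 6] (by simp) (by simp)
            (by decide +kernel)
      · exact (hasLoop_six h hE).packingColorable hn (by simp) rfl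
    · rcases Nat.lt_or_ge 5 n with h | h
      · exact not_packingColorable_five_of_lt h
      · obtain rfl : n = 5 := by omega
        exact not_packingColorable_five_five
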